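/- Let $p,q\ge 0$ be integers with $n=p+q\ge 1$, and let $\mathrm{Cl}(p,q)$ be the complex Clifford algebra with identity $e$ and generators $e^1,\dots,e^n$ satisfying $e^ae^b+e^be^a=2\eta^{ab}e$, where $\eta=\mathrm{diag}(1,\dots,1,-1,\dots,-1)$ with $p$ entries $+1$ followed by $q$ entries $-1$. The elements $e^{a_1}\cdots e^{a_k}$ ($1\le a_1<\dots<a_k\le n$, $1\le k\le n$) together with $e$ form a basis of $\mathrm{Cl}(p,q)$ over $\mathbb C$, and the trace $\mathrm{Tr}(U)\in\mathbb C$ of $U\in\mathrm{Cl}(p,q)$ is defined as the coefficient of $e$ in the expansion of $U$ in this basis. A matrix representation of minimal dimension is an injective (faithful) unital $\mathbb C$-algebra homomorphism $\gamma:\mathrm{Cl}(p,q)\to M_d(\mathbb C)$ such that $d$ is the least possible among all faithful unital matrix representations of $\mathrm{Cl}(p,q)$. Then matrix representations of minimal dimension exist, their dimension is $d=2^{[(n+1)/2]}$ (where $[\cdot]$ is the integer part), and for every such representation $\gamma$ and every $U\in\mathrm{Cl}(p,q)$ $$\mathrm{Tr}(U)=\frac{1}{2^{[\frac{n+1}{2}]}}\,\mathrm{tr}(\gamma(U)).$$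 In particular, the right-hand side does not depend on the choice of $\gamma$, so it gives a well-defined alternative definition of the trace, and this definition is equivalent to the one above: a function $T:\mathrm{Cl}(p,q)\to\mathbb C$ is of the form $T(U)=2^{-[(n+1)/2]}\,\mathrm{tr}(\gamma(U))$ for all $U$, for some matrix representation $\gamma$ of minimal dimension, if and only if $T=\mathrm{Tr}$. -/

import Mathlib

namespace CliffordTrace

/-- The diagonal entries `η^{aa}` of `η`: first `p` entries `+1`, then `q` entries `-1`. -/
def signature (p q : ℕ) (a : Fin (p + q)) : ℂ := if (a : ℕ) < p then 1 else -1

/-- The quadratic form `v ↦ ∑ a, η^{aa} (v a)²` on `ℂ^{p+q}`. -/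
noncomputable def form (p q : ℕ) : QuadraticForm ℂ (Fin (p + q) → ℂ) :=
  QuadraticMap.weightedSumSquares ℂ (signature p q)

/-- The complex Clifford algebra `Cl(p,q)`. -/
abbrev Cl (p q : ℕ) : Type := CliffordAlgebra (form p q)

/-- The generator `e^a`. -/
noncomputable def gen (p q : ℕ) (a : Fin (p + q)) : Cl p q :=
  CliffordAlgebra.ι (form p q) (Pi.single a 1)

theorem form_single (p q : ℕ) (a : Fin (p + q)) :
    form p q (Pi.single a 1) = signature p q a := by
  simp [form, QuadraticMap.weightedSumSquares_apply, Pi.single_apply]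

theorem form_isOrtho (p q : ℕ) {a b : Fin (p + q)} (h : a ≠ b) :
    (form p q).IsOrtho (Pi.single a 1) (Pi.single b 1) := by
  rw [QuadraticMap.isOrtho_def, form_single, form_single]
  simp only [form, QuadraticMap.weightedSumSquares_apply, Pi.add_apply, Pi.single_apply]
  rw [← Finset.sum_ite_eq_of_mem' Finset.univ a (signature p q) (Finset.mem_univ a),
    ← Finset.sum_ite_eq_of_mem' Finset.univ b (signature p q) (Finset.mem_univ b),
    ← Finset.sum_add_distrib]
  refine Finset.sum_congr rfl fun c _ => ?_
  by_cases h₁ : c = a <;> by_cases h₂ : c = b <;> simp_all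

/-- The defining relations `e^a e^b + e^b e^a = 2 η^{ab} e`. -/
theorem gen_mul_gen_add (p q : ℕ) (a b : Fin (p + q)) :
    gen p q a * gen p q b + gen p q b * gen p q a =
      algebraMap ℂ (Cl p q) (2 * Matrix.diagonal (signature p q) a b) := by
  by_cases h : a = b
  · subst h
    simp only [gen, CliffordAlgebra.ι_sq_scalar, form_single, Matrix.diagonal_apply_eq]
    rw [← map_add, two_mul]
  · rw [Matrix.diagonal_apply_ne _ h, mul_zero, map_zero]
    exact CliffordAlgebra.ι_mul_ι_add_swap_of_isOrtho (form_isOrtho p q h)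

/-- The element `e^{a₁ … a_k} = e^{a₁} ⋯ e^{a_k}` for `A = {a₁ < … < a_k}`; for `A = ∅` it is the
identity element `e`. -/
noncomputable def blade (p q : ℕ) (A : Finset (Fin (p + q))) : Cl p q :=
  ((A.sort (· ≤ ·)).map (gen p q)).prod

theorem contractLeft_prod_eq_zero {M : Type*} [AddCommGroup M] [Module ℂ M]
    (Q : QuadraticForm ℂ M) (d : Module.Dual ℂ M) (l : List M) (h : ∀ x ∈ l, d x = 0) :
    CliffordAlgebra.contractLeft d (l.map (CliffordAlgebra.ι Q)).prod = 0 := by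
  induction l with
  | nil => simp
  | cons x l ih =>
    rw [List.map_cons, List.prod_cons, CliffordAlgebra.contractLeft_ι_mul,
      ih fun y hy => h y (List.mem_cons_of_mem _ hy), h x List.mem_cons_self]
    simp

theorem changeForm_prod {M : Type*} [AddCommGroup M] [Module ℂ M] {Q Q' : QuadraticForm ℂ M}
    {B : LinearMap.BilinForm ℂ M} (h : B.toQuadraticMap = Q' - Q) (l : List M)
    (hl : l.Pairwise fun x y => B x y = 0) :
    CliffordAlgebra.changeForm h (l.map (CliffordAlgebra.ι Q)).prod =
      (l.map (CliffordAlgebra.ι Q')).prod := by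
  induction l with
  | nil => simp
  | cons x l ih =>
    rw [List.pairwise_cons] at hl
    rw [List.map_cons, List.prod_cons, CliffordAlgebra.changeForm_ι_mul, ih hl.2,
      contractLeft_prod_eq_zero _ _ _ hl.1, sub_zero, List.map_cons, List.prod_cons]

theorem exteriorBasis_apply (n : ℕ) (A : Finset (Fin n)) :
    (Pi.basisFun ℂ (Fin n)).ExteriorAlgebra A =
      ((A.sort (· ≤ ·)).map fun a => ExteriorAlgebra.ι ℂ (Pi.single a (1 : ℂ))).prod := by
  rw [ExteriorAlgebra.basis_apply_ofCard (Pi.basisFun ℂ (Fin n)) (n := A.card) rfl,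
    ExteriorAlgebra.ιMulti_family, ExteriorAlgebra.ιMulti_apply,
    ← Finset.listMap_orderEmbOfFin_finRange A rfl, List.map_map, List.ofFn_eq_map]
  congr 1
  refine List.map_congr_left fun i _ => ?_
  simp only [Function.comp_apply, Pi.basisFun_apply]
  rfl

theorem changeForm_blade (p q : ℕ) (A : Finset (Fin (p + q))) :
    CliffordAlgebra.changeFormEquiv
        (CliffordAlgebra.changeForm.associated_neg_proof (Q := form p q)) (blade p q A) =
      (Pi.basisFun ℂ (Fin (p + q))).ExteriorAlgebra A := by
  have hb : blade p q A = (((A.sort (· ≤ ·)).map fun a => (Pi.single a 1 : Fin (p + q) → ℂ)).map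
      (CliffordAlgebra.ι (form p q))).prod := by
    rw [List.map_map]; rfl
  rw [CliffordAlgebra.changeFormEquiv_apply, hb, changeForm_prod, exteriorBasis_apply, List.map_map]
  · rfl
  · rw [List.pairwise_map]
    refine (A.sort_nodup (· ≤ ·)).imp fun {a b} hab => ?_
    rw [map_neg, LinearMap.neg_apply, LinearMap.neg_apply, neg_eq_zero,
      QuadraticMap.associated_isOrtho]
    exact form_isOrtho p q hab

theorem blade_eq (p q : ℕ) :
    blade p q = (CliffordAlgebra.changeFormEquiv
      (CliffordAlgebra.changeForm.associated_neg_proof (Q := form p q))).symm ∘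
        (Pi.basisFun ℂ (Fin (p + q))).ExteriorAlgebra := by
  funext A
  rw [Function.comp_apply, LinearEquiv.eq_symm_apply, changeForm_blade]

theorem blade_linearIndependent (p q : ℕ) : LinearIndependent ℂ (blade p q) := by
  rw [blade_eq]
  exact (Module.Basis.linearIndependent _).map' _ (LinearEquiv.ker _)

theorem blade_span (p q : ℕ) : ⊤ ≤ Submodule.span ℂ (Set.range (blade p q)) := by
  rw [blade_eq, Set.range_comp, ← LinearEquiv.coe_coe, ← Submodule.map_span, Module.Basis.span_eq,
    Submodule.map_top, LinearEquiv.range]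

/-- The basis of `Cl(p,q)` formed by the `2^{p+q}` elements `e^{a₁ … a_k}`, `a₁ < … < a_k`. -/
noncomputable def bladeBasis (p q : ℕ) : Module.Basis (Finset (Fin (p + q))) ℂ (Cl p q) :=
  Module.Basis.mk (blade_linearIndependent p q) (blade_span p q)

/-- The trace `Tr(U)`: the coefficient `u` of the identity element `e = e^∅` in the expansion
`U = u e + ∑ u_a e^a + ∑ u_{ab} e^{ab} + …`. -/
noncomputable def Tr {p q : ℕ} (U : Cl p q) : ℂ := (bladeBasis p q).repr U ∅

/-- `γ`, a representation of `Cl(p,q)` by complex `d × d` matrices, is faithful, and no faithful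
matrix representation of `Cl(p,q)` has smaller dimension. -/
def IsMinimalRep {p q d : ℕ} (γ : Cl p q →ₐ[ℂ] Matrix (Fin d) (Fin d) ℂ) : Prop :=
  Function.Injective γ ∧
    ∀ (m : ℕ) (β : Cl p q →ₐ[ℂ] Matrix (Fin m) (Fin m) ℂ), Function.Injective β → d ≤ m

end CliffordTrace

namespace CliffordTrace

open Finset

/-! Both sides are linear in U, so the formula only has to be checked on blades: in a faithful
representation of dimension `2^[(n+1)/2]`, every blade except the identity must be traceless. If a
blade anticommutes with a generator, cyclicity of the trace kills it; this covers all nonempty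
blades except the full product ω when n is odd, where ω is central.

For n = 2k+1, a scalar s with ω² = s² gives two central idempotents (1 ± s⁻¹ω)/2. Faithfulness makes
both of their ranges nonzero, and a nonzero representation has dimension at least 2^k, because the
blades avoiding one generator stay independent (they are orthogonal for the trace form). So d ≥
2^(k+1), and equality forces two eigenspaces of equal dimension, that is tr ω = 0. For n even, d² ≥
2^n is just injectivity.

The bound is attained on the exterior algebra of ℂ^N, N = [(n+1)/2], by exterior multiplication plus
contraction. Faithfulness there again follows from traceless blades; for odd n, ω anticommutes with
the parity operator. -/

theorem mul_list_prod_of_anticomm {R : Type*} [Ring R] (g : R) (l : List R)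
    (h : ∀ x ∈ l, g * x = -(x * g)) : g * l.prod = (-1) ^ l.length * (l.prod * g) := by
  induction l with
  | nil => simp
  | cons x l ih =>
    rw [List.prod_cons, ← mul_assoc, h x List.mem_cons_self, neg_mul, mul_assoc,
      ih fun y hy => h y (List.mem_cons_of_mem _ hy), List.length_cons, pow_succ,
      ← mul_assoc x, ← ((Commute.neg_one_left x).pow_left l.length).eq]
    simp [mul_assoc]

theorem mul_list_prod_of_anticomm_of_odd {R : Type*} [Ring R] (g : R) {l : List R}
    (hl : Odd l.length) (h : ∀ x ∈ l, g * x = -(x * g)) : g * l.prod = -(l.prod * g) := by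
  rw [mul_list_prod_of_anticomm g l h, hl.neg_one_pow, neg_one_mul]

/-! ### Multiplication and commutation of blades -/

section Blade

variable {p q : ℕ}

theorem signature_ne_zero (a : Fin (p + q)) : signature p q a ≠ 0 := by
  unfold signature; split_ifs <;> simp

theorem gen_mul_self (a : Fin (p + q)) :
    gen p q a * gen p q a = signature p q a • (1 : Cl p q) := by
  rw [gen, CliffordAlgebra.ι_sq_scalar, form_single, Algebra.algebraMap_eq_smul_one]

theorem gen_anticomm {a b : Fin (p + q)} (h : a ≠ b) :
    gen p q a * gen p q b = -(gen p q b * gen p q a) := by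
  rw [eq_neg_iff_add_eq_zero, gen_mul_gen_add, Matrix.diagonal_apply_ne _ h, mul_zero, map_zero]

theorem blade_empty : blade p q ∅ = 1 := by simp [blade]

theorem gen_mul_blade_of_notMem {a : Fin (p + q)} {A : Finset (Fin (p + q))} (h : a ∉ A) :
    gen p q a * blade p q A = (-1) ^ #A * (blade p q A * gen p q a) := by
  rw [blade, mul_list_prod_of_anticomm, List.length_map, Finset.length_sort]
  intro x hx
  obtain ⟨b, hb, rfl⟩ := List.mem_map.1 hx
  refine gen_anticomm ?_
  rintro rfl
  exact h ((Finset.mem_sort _).1 hb)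

/-- Each swap of distinct generators costs a sign. Only the nonvanishing of the scalar is ever used,
so signs are not tracked. -/
theorem prod_gen_perm {l l' : List (Fin (p + q))} (h : l.Perm l') (hl : l.Nodup) :
    ∃ c : ℂ, c ≠ 0 ∧ (l.map (gen p q)).prod = c • (l'.map (gen p q)).prod := by
  induction h with
  | nil => exact ⟨1, one_ne_zero, by simp⟩
  | cons x _ ih =>
    obtain ⟨c, hc, h⟩ := ih hl.of_cons
    exact ⟨c, hc, by simp [h]⟩
  | swap x y l =>
    refine ⟨-1, by simp, ?_⟩
    have hxy : y ≠ x := by rintro rfl; simp at hl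
    simp only [List.map_cons, List.prod_cons, ← mul_assoc]
    rw [gen_anticomm hxy]
    simp
  | trans h₁ _ ih₁ ih₂ =>
    obtain ⟨c, hc, h⟩ := ih₁ hl
    obtain ⟨c', hc', h'⟩ := ih₂ (h₁.nodup_iff.1 hl)
    exact ⟨c * c', mul_ne_zero hc hc', by rw [h, h', smul_smul]⟩

theorem gen_mul_blade (a : Fin (p + q)) (A : Finset (Fin (p + q))) :
    ∃ c : ℂ, c ≠ 0 ∧ gen p q a * blade p q A = c • blade p q (symmDiff {a} A) := by
  have key : ∀ B : Finset (Fin (p + q)), a ∉ B →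
      ∃ c : ℂ, c ≠ 0 ∧ gen p q a * blade p q B = c • blade p q (insert a B) := by
    intro B hB
    have hn : (a :: B.sort (· ≤ ·)).Nodup := by simp [hB, Finset.sort_nodup]
    have hp : (a :: B.sort (· ≤ ·)).Perm ((insert a B).sort (· ≤ ·)) := by
      rw [List.perm_ext_iff_of_nodup hn (Finset.sort_nodup _ _)]
      simp
    obtain ⟨c, hc, h⟩ := prod_gen_perm hp hn
    exact ⟨c, hc, by rw [blade, blade, ← h]; simp⟩
  by_cases ha : a ∈ A
  · obtain ⟨c, hc, h⟩ := key (A.erase a) (notMem_erase a A)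
    rw [insert_erase ha] at h
    refine ⟨c⁻¹ * signature p q a, mul_ne_zero (inv_ne_zero hc) (signature_ne_zero a), ?_⟩
    have hs : symmDiff {a} A = A.erase a := by
      ext b; by_cases hb : b = a <;> simp [mem_symmDiff, hb, ha]
    have h' : blade p q A = c⁻¹ • (gen p q a * blade p q (A.erase a)) := by
      rw [h, smul_smul, inv_mul_cancel₀ hc, one_smul]
    rw [hs, h', mul_smul_comm, ← mul_assoc, gen_mul_self, smul_mul_assoc, one_mul, smul_smul]
  · have hs : symmDiff {a} A = insert a A := by
      ext b; by_cases hb : b = a <;> simp [mem_symmDiff, hb, ha]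
    rw [hs]
    exact key A ha

/-- Repeated generators cancel, as they square to ±1: up to nonzero scalars, blades multiply like
subsets under symmetric difference. -/
theorem blade_mul_blade (A B : Finset (Fin (p + q))) :
    ∃ c : ℂ, c ≠ 0 ∧ blade p q A * blade p q B = c • blade p q (symmDiff A B) := by
  have key : ∀ l : List (Fin (p + q)), l.Nodup → ∃ c : ℂ, c ≠ 0 ∧
      (l.map (gen p q)).prod * blade p q B = c • blade p q (symmDiff l.toFinset B) := by
    intro l
    induction l with
    | nil => exact fun _ => ⟨1, one_ne_zero, by simp [← Finset.bot_eq_empty]⟩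
    | cons a l ih =>
      intro hl
      rw [List.nodup_cons] at hl
      obtain ⟨c, hc, h⟩ := ih hl.2
      obtain ⟨c', hc', h'⟩ := gen_mul_blade a (symmDiff l.toFinset B)
      refine ⟨c * c', mul_ne_zero hc hc', ?_⟩
      have hs : (a :: l).toFinset = symmDiff {a} l.toFinset := by
        ext b; by_cases hb : b = a <;> simp [mem_symmDiff, hb, hl.1]
      rw [List.map_cons, List.prod_cons, mul_assoc, h, mul_smul_comm, h', smul_smul, hs,
        symmDiff_assoc]
  obtain ⟨c, hc, h⟩ := key _ (A.sort_nodup (· ≤ ·))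
  rw [Finset.sort_toFinset] at h
  exact ⟨c, hc, h⟩

theorem gen_mul_blade_of_mem {a : Fin (p + q)} {A : Finset (Fin (p + q))} (h : a ∈ A) :
    gen p q a * blade p q A = (-1) ^ (#A + 1) * (blade p q A * gen p q a) := by
  obtain ⟨c, hc, hA⟩ := gen_mul_blade a (A.erase a)
  have hs : symmDiff {a} (A.erase a) = A := by
    ext b; by_cases hb : b = a <;> simp [mem_symmDiff, hb, h]
  have hA' : blade p q A = c⁻¹ • (gen p q a * blade p q (A.erase a)) := by
    rw [hA, hs, smul_smul, inv_mul_cancel₀ hc, one_smul]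
  have hcard : #A + 1 = #(A.erase a) + 2 := by
    rw [← card_erase_add_one h]
  rw [hA', mul_smul_comm, smul_mul_assoc, mul_smul_comm, mul_assoc,
    gen_mul_blade_of_notMem (notMem_erase a A), hcard, pow_add, neg_one_sq, mul_one,
    ← mul_assoc, ← mul_assoc, ← mul_assoc,
    ((Commute.neg_one_left (gen p q a)).pow_left _).eq]
  simp only [mul_assoc]

/-- In odd dimension the product of all generators is central. -/
theorem blade_univ_commute (hn : Odd (p + q)) (U : Cl p q) : Commute U (blade p q univ) := by
  have hι : ∀ x, Commute (CliffordAlgebra.ι (form p q) x) (blade p q univ) := by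
    intro x
    have : LinearMap.mulRight ℂ (blade p q univ) ∘ₗ CliffordAlgebra.ι (form p q) =
        LinearMap.mulLeft ℂ (blade p q univ) ∘ₗ CliffordAlgebra.ι (form p q) := by
      refine LinearMap.pi_ext' fun a => LinearMap.ext_ring ?_
      have := gen_mul_blade_of_mem (mem_univ a)
      rw [card_univ, Fintype.card_fin, hn.add_one.neg_one_pow, one_mul] at this
      simpa [gen] using this
    exact LinearMap.congr_fun this x
  induction U using CliffordAlgebra.induction with
  | algebraMap r => exact Algebra.commutes r _
  | ι x => exact hι x
  | mul a b ha hb => exact ha.mul_left hb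
  | add a b ha hb => exact ha.add_left hb

theorem blade_mul_self (A : Finset (Fin (p + q))) :
    ∃ c : ℂ, c ≠ 0 ∧ blade p q A * blade p q A = c • (1 : Cl p q) := by
  obtain ⟨c, hc, h⟩ := blade_mul_blade A A
  exact ⟨c, hc, by rw [h, symmDiff_self, Finset.bot_eq_empty, blade_empty]⟩

theorem Tr_blade (A : Finset (Fin (p + q))) : Tr (blade p q A) = if A = ∅ then 1 else 0 := by
  have : blade p q A = bladeBasis p q A := by simp [bladeBasis]
  rw [Tr, this, Module.Basis.repr_self, Finsupp.single_apply]

theorem finrank_Cl : Module.finrank ℂ (Cl p q) = 2 ^ (p + q) := by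
  rw [Module.finrank_eq_card_basis (bladeBasis p q), Fintype.card_finset, Fintype.card_fin]

end Blade

/-! ### Traceless blades and linear independence -/

section Trace

variable {p q : ℕ} {V : Type*} [AddCommGroup V] [Module ℂ V]

/-- The trace of `G * X * G` is `c * tr X` by cyclicity and `-(c * tr X)` by anticommutation. -/
theorem trace_eq_zero_of_anticomm {X G : Module.End ℂ V} {c : ℂ} (hc : c ≠ 0)
    (hG : G * G = c • 1) (h : G * X = -(X * G)) : LinearMap.trace ℂ V X = 0 := by
  have h₁ : LinearMap.trace ℂ V (G * X * G) = -(c * LinearMap.trace ℂ V X) := by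
    rw [h, neg_mul, mul_assoc, hG, map_neg, mul_smul_comm, mul_one, map_smul, smul_eq_mul]
  have h₂ : LinearMap.trace ℂ V (G * X * G) = c * LinearMap.trace ℂ V X := by
    rw [LinearMap.trace_mul_comm, ← mul_assoc, hG, smul_mul_assoc, one_mul, map_smul, smul_eq_mul]
  have h₃ : c * LinearMap.trace ℂ V X = 0 := self_eq_neg.1 (h₂.symm.trans h₁)
  exact (mul_eq_zero.1 h₃).resolve_left hc

/-- A blade that anticommutes with some generator is traceless in every representation. -/
theorem trace_blade_eq_zero (ρ : Cl p q →ₐ[ℂ] Module.End ℂ V) {A : Finset (Fin (p + q))}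
    (hA : A ≠ ∅) (h : A ≠ univ ∨ Even (p + q)) : LinearMap.trace ℂ V (ρ (blade p q A)) = 0 := by
  suffices H : ∃ a, gen p q a * blade p q A = -(blade p q A * gen p q a) by
    obtain ⟨a, ha⟩ := H
    refine trace_eq_zero_of_anticomm (G := ρ (gen p q a)) (signature_ne_zero a) ?_ ?_
    · rw [← map_mul, gen_mul_self, map_smul, map_one]
    · rw [← map_mul, ha, map_neg, map_mul]
  rcases Nat.even_or_odd #A with he | ho
  · obtain ⟨a, ha⟩ := nonempty_iff_ne_empty.2 hA
    exact ⟨a, by rw [gen_mul_blade_of_mem ha, he.add_one.neg_one_pow, neg_one_mul]⟩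
  · have hA' : A ≠ univ := by
      rcases h with h | h
      · exact h
      · rintro rfl
        rw [card_univ, Fintype.card_fin] at ho
        exact Nat.not_even_iff_odd.2 ho h
    obtain ⟨a, ha⟩ : ∃ a, a ∉ A := by simpa [eq_univ_iff_forall] using hA'
    exact ⟨a, by rw [gen_mul_blade_of_notMem ha, ho.neg_one_pow, neg_one_mul]⟩

variable [FiniteDimensional ℂ V] [Nontrivial V]

/-- The images are orthogonal for the form (X, Y) ↦ tr(XY), and none is isotropic: a blade squares
to a nonzero scalar and `V` is nonzero. -/
theorem linearIndependent_of_trace_blade (ρ : Cl p q →ₐ[ℂ] Module.End ℂ V)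
    (S : Finset (Finset (Fin (p + q))))
    (h : ∀ A ∈ S, ∀ B ∈ S, A ≠ B → LinearMap.trace ℂ V (ρ (blade p q (symmDiff A B))) = 0) :
    LinearIndependent ℂ fun A : S => ρ (blade p q A) := by
  have hB : ∀ A B : Finset (Fin (p + q)), ∃ c : ℂ, c ≠ 0 ∧
      ((LinearMap.mul ℂ (Module.End ℂ V)).compr₂ (LinearMap.trace ℂ V))
        (ρ (blade p q A)) (ρ (blade p q B)) =
          c * LinearMap.trace ℂ V (ρ (blade p q (symmDiff A B))) := by
    intro A B
    obtain ⟨c, hc, hAB⟩ := blade_mul_blade A B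
    refine ⟨c, hc, ?_⟩
    rw [LinearMap.compr₂_apply, LinearMap.mul_apply', ← map_mul, hAB, map_smul, map_smul,
      smul_eq_mul]
  refine LinearMap.linearIndependent_of_isOrthoᵢ
    (B := (LinearMap.mul ℂ (Module.End ℂ V)).compr₂ (LinearMap.trace ℂ V)) ?_ ?_
  · rw [LinearMap.isOrthoᵢ_def]
    rintro ⟨A, hA⟩ ⟨B, hB'⟩ hne
    obtain ⟨c, -, hc⟩ := hB A B
    rw [hc, h A hA B hB' fun h => hne (Subtype.ext h), mul_zero]
  · rintro ⟨A, hA⟩ hA0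
    obtain ⟨c, hc0, hc⟩ := hB A A
    rw [hc, symmDiff_self, Finset.bot_eq_empty, blade_empty, map_one,
      LinearMap.trace_one] at hA0
    exact mul_ne_zero hc0 (Nat.cast_ne_zero.2 Module.finrank_pos.ne') hA0

theorem card_le_of_trace_blade (ρ : Cl p q →ₐ[ℂ] Module.End ℂ V)
    (S : Finset (Finset (Fin (p + q))))
    (h : ∀ A ∈ S, ∀ B ∈ S, A ≠ B → LinearMap.trace ℂ V (ρ (blade p q (symmDiff A B))) = 0) :
    #S ≤ Module.finrank ℂ V ^ 2 := by
  have := (linearIndependent_of_trace_blade ρ S h).fintype_card_le_finrank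
  rwa [Fintype.card_coe, Module.finrank_linearMap, ← sq] at this

/-- A nontrivial representation of `Cl(p,q)`, `p + q = 2k + 1`, has dimension at least `2^k`. -/
theorem two_pow_le_finrank {k : ℕ} (hk : p + q = 2 * k + 1) (ρ : Cl p q →ₐ[ℂ] Module.End ℂ V) :
    2 ^ k ≤ Module.finrank ℂ V := by
  -- Any one generator may be dropped: the symmetric difference of two sets avoiding `a` is never
  -- `univ`, so the central blade does not occur. This leaves 2^(2k) independent operators.
  let a : Fin (p + q) := ⟨0, by omega⟩
  have := card_le_of_trace_blade ρ ((univ : Finset (Fin (p + q))).erase a).powerset ?_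
  · rw [card_powerset, card_erase_of_mem (mem_univ a), card_univ, Fintype.card_fin, hk,
      Nat.add_sub_cancel, mul_comm, pow_mul] at this
    exact (Nat.pow_le_pow_iff_left two_ne_zero).1 this
  · intro A hA B hB hAB
    refine trace_blade_eq_zero ρ (by rwa [← Finset.bot_eq_empty, Ne, symmDiff_eq_bot])
      (Or.inl fun hu => ?_)
    have ha : a ∈ symmDiff A B := hu ▸ mem_univ a
    rw [mem_symmDiff] at ha
    rcases ha with ⟨ha, -⟩ | ⟨ha, -⟩
    · exact notMem_erase a _ (mem_powerset.1 hA ha)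
    · exact notMem_erase a _ (mem_powerset.1 hB ha)

theorem injective_of_trace_blade (ρ : Cl p q →ₐ[ℂ] Module.End ℂ V)
    (h : ∀ A : Finset (Fin (p + q)), A ≠ ∅ → LinearMap.trace ℂ V (ρ (blade p q A)) = 0) :
    Function.Injective ρ := by
  rw [injective_iff_map_eq_zero]
  intro U hU
  have hli := linearIndependent_of_trace_blade ρ univ fun A _ B _ hAB =>
    h _ (by rwa [← Finset.bot_eq_empty, Ne, symmDiff_eq_bot])
  have hli' : LinearIndependent ℂ fun A => ρ (blade p q A) :=
    hli.comp (fun A => ⟨A, mem_univ A⟩) fun A B hAB => by simpa using hAB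
  rw [Fintype.linearIndependent_iff] at hli'
  have hsum := (bladeBasis p q).sum_repr U
  have h0 := hli' (fun A => (bladeBasis p q).repr U A) (by
    rw [← hU]
    conv_rhs => rw [← hsum]
    simp [bladeBasis])
  rw [← hsum]
  simp [h0]

end Trace

end CliffordTrace
namespace CliffordTrace

open Finset

/-! ### Faithful representations: dimension bound and trace -/

section Odd

variable {p q : ℕ} {V : Type*} [AddCommGroup V] [Module ℂ V]

/-- The representation on an invariant subspace. -/
noncomputable def restrictRep {R : Type*} [Ring R] [Algebra ℂ R] (ρ : R →ₐ[ℂ] Module.End ℂ V)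
    (W : Submodule ℂ V) (h : ∀ U, ∀ w ∈ W, ρ U w ∈ W) : R →ₐ[ℂ] Module.End ℂ W :=
  AlgHom.ofLinearMap
    { toFun := fun U => (ρ U).restrict (h U)
      map_add' := fun U U' => by ext; simp
      map_smul' := fun c U => by ext; simp }
    (by ext; simp) (fun U U' => by ext; simp)

variable [FiniteDimensional ℂ V]

/-- The dimension of the eigenspace, for the eigenvalue `s`, of the central blade. -/
theorem exists_eigenspace_dim {k : ℕ} (hk : p + q = 2 * k + 1) (ρ : Cl p q →ₐ[ℂ] Module.End ℂ V)
    (hρ : Function.Injective ρ) {s : ℂ} (hs : s ≠ 0)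
    (hω : blade p q univ * blade p q univ = (s * s) • (1 : Cl p q)) :
    ∃ r : ℕ, 2 ^ k ≤ r ∧
      (2 * r : ℂ) = Module.finrank ℂ V + s⁻¹ * LinearMap.trace ℂ V (ρ (blade p q univ)) := by
  set P : Cl p q := (2⁻¹ : ℂ) • (1 + s⁻¹ • blade p q univ) with hP
  have hPP : P * P = P := by
    have : (s⁻¹ • blade p q univ) * (s⁻¹ • blade p q univ) = (1 : Cl p q) := by
      rw [smul_mul_smul_comm, hω, smul_smul]
      field_simp
      rw [one_smul]
    rw [hP, smul_mul_smul_comm, add_mul, mul_add, mul_add, this]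
    simp only [one_mul, mul_one]
    module
  have hPc : ∀ U, Commute U P := fun U =>
    ((Commute.one_right U).add_right
      ((blade_univ_commute ⟨k, hk⟩ U).smul_right s⁻¹)).smul_right _
  -- The coefficient of the identity in `P` is 1/2.
  have hP0 : P ≠ 0 := by
    intro h0
    have h1 := congrArg (fun U => (bladeBasis p q).repr U ∅) h0
    have h2 : Tr P = 2⁻¹ * (Tr (blade p q ∅) + s⁻¹ * Tr (blade p q univ)) := by
      rw [blade_empty]
      simp [hP, Tr, mul_add]
    have h3 : (univ : Finset (Fin (p + q))) ≠ ∅ := by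
      rw [← nonempty_iff_ne_empty]
      exact ⟨⟨0, by omega⟩, mem_univ _⟩
    rw [Tr_blade, Tr_blade, if_pos rfl, if_neg h3] at h2
    have h4 : Tr P = 0 := by simpa [Tr] using h1
    rw [h4] at h2
    norm_num at h2
  let W := LinearMap.range (ρ P)
  have hW : ∀ U, ∀ w ∈ W, ρ U w ∈ W := by
    rintro U _ ⟨v, rfl⟩
    refine ⟨ρ U v, ?_⟩
    rw [← Module.End.mul_apply, ← Module.End.mul_apply, ← map_mul, ← map_mul, (hPc U).eq]
  have hproj : LinearMap.IsProj W (ρ P) := by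
    refine ⟨fun x => ⟨x, rfl⟩, ?_⟩
    rintro _ ⟨v, rfl⟩
    rw [← Module.End.mul_apply, ← map_mul, hPP]
  have : Nontrivial W := by
    rw [Submodule.nontrivial_iff_ne_bot, Ne, LinearMap.range_eq_bot]
    exact fun h => hP0 (hρ (by rw [h, map_zero]))
  refine ⟨Module.finrank ℂ W, two_pow_le_finrank hk (restrictRep ρ W hW), ?_⟩
  rw [← hproj.trace, hP]
  simp only [map_smul, map_add, map_one, LinearMap.trace_one, smul_eq_mul]
  ring

/-- The square roots `s` and `-s` give eigenspaces of dimensions r, r' ≥ 2^k, with r + r' = dim V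
and r - r' = s⁻¹ tr ω. -/
theorem odd_faithful {k : ℕ} (hk : p + q = 2 * k + 1) (ρ : Cl p q →ₐ[ℂ] Module.End ℂ V)
    (hρ : Function.Injective ρ) :
    2 ^ (k + 1) ≤ Module.finrank ℂ V ∧ (Module.finrank ℂ V = 2 ^ (k + 1) →
      LinearMap.trace ℂ V (ρ (blade p q univ)) = 0) := by
  obtain ⟨c, hc, hω⟩ := blade_mul_self (univ : Finset (Fin (p + q)))
  obtain ⟨s, rfl⟩ := IsAlgClosed.exists_eq_mul_self c
  have hs : s ≠ 0 := left_ne_zero_of_mul hc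
  obtain ⟨r, hr, h⟩ := exists_eigenspace_dim hk ρ hρ hs hω
  obtain ⟨r', hr', h'⟩ := exists_eigenspace_dim hk ρ hρ (neg_ne_zero.2 hs) (by rwa [neg_mul_neg])
  rw [inv_neg] at h'
  have hd : r + r' = Module.finrank ℂ V := by
    have : ((r + r' : ℕ) : ℂ) = Module.finrank ℂ V := by
      push_cast
      linear_combination h / 2 + h' / 2
    exact_mod_cast this
  rw [pow_succ]
  refine ⟨by omega, fun hd' => ?_⟩
  obtain rfl : r = r' := by omega
  have : s⁻¹ * LinearMap.trace ℂ V (ρ (blade p q univ)) = 0 := by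
    linear_combination h' / 2 - h / 2
  exact (mul_eq_zero.1 this).resolve_left (inv_ne_zero hs)

theorem two_pow_le_finrank_of_injective (ρ : Cl p q →ₐ[ℂ] Module.End ℂ V)
    (hρ : Function.Injective ρ) : 2 ^ ((p + q + 1) / 2) ≤ Module.finrank ℂ V := by
  obtain ⟨k, hk | hk⟩ := Nat.even_or_odd' (p + q)
  · have := LinearMap.finrank_le_finrank_of_injective (f := ρ.toLinearMap) hρ
    rw [finrank_Cl, Module.finrank_linearMap, ← sq, hk, mul_comm, pow_mul] at this
    rw [hk, show (2 * k + 1) / 2 = k by omega]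
    exact (Nat.pow_le_pow_iff_left two_ne_zero).1 this
  · rw [hk, show (2 * k + 1 + 1) / 2 = k + 1 by omega]
    exact (odd_faithful hk ρ hρ).1

/-- In a faithful representation of dimension `2^[(n+1)/2]` all blades but the identity are
traceless. -/
theorem trace_eq_of_injective (ρ : Cl p q →ₐ[ℂ] Module.End ℂ V) (hρ : Function.Injective ρ)
    (hd : Module.finrank ℂ V = 2 ^ ((p + q + 1) / 2)) (U : Cl p q) :
    LinearMap.trace ℂ V (ρ U) = 2 ^ ((p + q + 1) / 2) * Tr U := by
  suffices h : LinearMap.trace ℂ V ∘ₗ ρ.toLinearMap =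
      (2 ^ ((p + q + 1) / 2) : ℂ) • (bladeBasis p q).coord ∅ from LinearMap.congr_fun h U
  refine (bladeBasis p q).ext fun A => ?_
  have hA : bladeBasis p q A = blade p q A := by simp [bladeBasis]
  rw [hA]
  change LinearMap.trace ℂ V (ρ (blade p q A)) = 2 ^ ((p + q + 1) / 2) * Tr (blade p q A)
  rw [Tr_blade]
  split_ifs with h
  · rw [h, blade_empty, map_one, LinearMap.trace_one, hd, mul_one]
    push_cast
    rfl
  · rw [mul_zero]
    by_cases h' : A ≠ univ ∨ Even (p + q)
    · exact trace_blade_eq_zero ρ h h'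
    · rw [not_or, not_not, Nat.not_even_iff_odd] at h'
      obtain ⟨rfl, k, hk⟩ := h'
      refine (odd_faithful hk ρ hρ).2 (hd.trans ?_)
      rw [hk, show (2 * k + 1 + 1) / 2 = k + 1 by omega]

end Odd

/-! ### The spinor representation on the exterior algebra -/

section Spinor

variable {N : ℕ}

/-- `v ∧ · + d ⌋ ·` on the exterior algebra. -/
noncomputable def cliffordAct (v : Fin N → ℂ) (d : Module.Dual ℂ (Fin N → ℂ)) :
    Module.End ℂ (ExteriorAlgebra ℂ (Fin N → ℂ)) :=
  LinearMap.mulLeft ℂ (ExteriorAlgebra.ι ℂ v) +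
    CliffordAlgebra.contractLeft (Q := (0 : QuadraticForm ℂ (Fin N → ℂ))) d

/-- Exterior multiplication and contraction each square to zero, and their anticommutator is `d v`.
-/
theorem cliffordAct_mul_self (v : Fin N → ℂ) (d : Module.Dual ℂ (Fin N → ℂ)) :
    cliffordAct v d * cliffordAct v d = d v • 1 := by
  refine LinearMap.ext fun x => ?_
  have h1 := CliffordAlgebra.contractLeft_ι_mul (Q := (0 : QuadraticForm ℂ (Fin N → ℂ))) d v x
  have h2 := CliffordAlgebra.contractLeft_contractLeft
    (Q := (0 : QuadraticForm ℂ (Fin N → ℂ))) d x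
  have h3 : ExteriorAlgebra.ι ℂ v * (ExteriorAlgebra.ι ℂ v * x) = 0 := by
    rw [← mul_assoc, ExteriorAlgebra.ι_sq_zero, zero_mul]
  change ExteriorAlgebra.ι ℂ v * (ExteriorAlgebra.ι ℂ v * x +
    CliffordAlgebra.contractLeft d x) + CliffordAlgebra.contractLeft d
      (CliffordAlgebra.ι 0 v * x + CliffordAlgebra.contractLeft d x) = d v • x
  rw [map_add, h1, h2, mul_add, h3, ExteriorAlgebra.ι]
  abel

/-- The parity operator on the exterior algebra. -/
noncomputable def parity (N : ℕ) : Module.End ℂ (ExteriorAlgebra ℂ (Fin N → ℂ)) :=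
  (CliffordAlgebra.involute (Q := (0 : QuadraticForm ℂ (Fin N → ℂ)))).toLinearMap

theorem parity_mul_self : parity N * parity N = (1 : ℂ) • 1 := by
  refine LinearMap.ext fun x => ?_
  simp [parity]

theorem parity_contractLeft (d : Module.Dual ℂ (Fin N → ℂ))
    (x : ExteriorAlgebra ℂ (Fin N → ℂ)) :
    parity N (CliffordAlgebra.contractLeft (Q := (0 : QuadraticForm ℂ (Fin N → ℂ))) d x) =
      -CliffordAlgebra.contractLeft (Q := (0 : QuadraticForm ℂ (Fin N → ℂ))) d (parity N x) := by
  change CliffordAlgebra.involute _ = -CliffordAlgebra.contractLeft d (CliffordAlgebra.involute x)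
  induction x using CliffordAlgebra.left_induction with
  | algebraMap r => simp [CliffordAlgebra.contractLeft_algebraMap]
  | add x y hx hy => simp only [map_add, hx, hy]; abel
  | ι_mul x m hx =>
    rw [CliffordAlgebra.contractLeft_ι_mul, map_sub, map_smul, map_mul, map_mul, hx,
      CliffordAlgebra.involute_ι, neg_mul, neg_mul]
    rw [map_neg (CliffordAlgebra.contractLeft d), CliffordAlgebra.contractLeft_ι_mul]
    simp

theorem parity_mul_cliffordAct (v : Fin N → ℂ) (d : Module.Dual ℂ (Fin N → ℂ)) :
    parity N * cliffordAct v d = -(cliffordAct v d * parity N) := by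
  refine LinearMap.ext fun x => ?_
  have h : parity N (ExteriorAlgebra.ι ℂ v * x) = -(ExteriorAlgebra.ι ℂ v * parity N x) := by
    change CliffordAlgebra.involute (CliffordAlgebra.ι 0 v * x) =
      -(CliffordAlgebra.ι 0 v * CliffordAlgebra.involute x)
    rw [map_mul, CliffordAlgebra.involute_ι, neg_mul]
  change parity N (ExteriorAlgebra.ι ℂ v * x + CliffordAlgebra.contractLeft d x) =
    -(ExteriorAlgebra.ι ℂ v * parity N x + CliffordAlgebra.contractLeft d (parity N x))
  rw [map_add, h, parity_contractLeft, neg_add]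

/-- The `k`-th coordinate, rescaled to turn `form p q` into a sum of squares; zero for
`k ≥ p + q`. -/
noncomputable def scaledCoord (p q k : ℕ) : (Fin (p + q) → ℂ) →ₗ[ℂ] ℂ :=
  if h : k < p + q then (if k < p then 1 else Complex.I) • LinearMap.proj ⟨k, h⟩ else 0

theorem sum_scaledCoord_sq {p q m : ℕ} (hm : p + q ≤ m) (x : Fin (p + q) → ℂ) :
    ∑ k ∈ range m, scaledCoord p q k x * scaledCoord p q k x = form p q x := by
  have h : ∑ k ∈ range m, scaledCoord p q k x * scaledCoord p q k x =
      ∑ k ∈ range (p + q), scaledCoord p q k x * scaledCoord p q k x := by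
    refine (sum_subset (range_subset_range.2 hm) fun k _ hk => ?_).symm
    rw [mem_range] at hk
    simp [scaledCoord, hk]
  rw [h, ← Fin.sum_univ_eq_sum_range, form, QuadraticMap.weightedSumSquares_apply]
  refine sum_congr rfl fun a _ => ?_
  have hI : Complex.I * x a * (Complex.I * x a) = -(x a * x a) := by
    linear_combination (x a * x a) * Complex.I_mul_I
  by_cases ha : (a : ℕ) < p
  · simp [scaledCoord, signature, ha]
  · simp [scaledCoord, signature, ha, hI]

theorem sum_range_two_mul (f : ℕ → ℂ) (N : ℕ) :
    ∑ k ∈ range (2 * N), f k = ∑ j ∈ range N, (f (2 * j) + f (2 * j + 1)) := by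
  induction N with
  | zero => simp
  | succ N ih => rw [mul_add, mul_one, sum_range_succ, sum_range_succ, sum_range_succ, ih, add_assoc]

/-- The vector part of the spinor action. -/
noncomputable def spinorVec (p q N : ℕ) : (Fin (p + q) → ℂ) →ₗ[ℂ] (Fin N → ℂ) :=
  LinearMap.pi fun j => scaledCoord p q (2 * j) + Complex.I • scaledCoord p q (2 * j + 1)

/-- The covector part of the spinor action. -/
noncomputable def spinorDual (p q N : ℕ) : (Fin (p + q) → ℂ) →ₗ[ℂ] Module.Dual ℂ (Fin N → ℂ) :=
  (dotProductEquiv ℂ (Fin N)).toLinearMap ∘ₗ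
    LinearMap.pi fun j => scaledCoord p q (2 * j) - Complex.I • scaledCoord p q (2 * j + 1)

/-- Coordinates are paired by (a - ib)(a + ib) = a² + b²; any left over are padded with zeros. -/
theorem spinorDual_spinorVec {p q N : ℕ} (hN : p + q ≤ 2 * N) (x : Fin (p + q) → ℂ) :
    spinorDual p q N x (spinorVec p q N x) = form p q x := by
  rw [← sum_scaledCoord_sq hN, sum_range_two_mul, ← Fin.sum_univ_eq_sum_range
    (fun j => scaledCoord p q (2 * j) x * scaledCoord p q (2 * j) x +
      scaledCoord p q (2 * j + 1) x * scaledCoord p q (2 * j + 1) x)]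
  change ∑ j : Fin N, (scaledCoord p q (2 * j) x - Complex.I * scaledCoord p q (2 * j + 1) x) *
    (scaledCoord p q (2 * j) x + Complex.I * scaledCoord p q (2 * j + 1) x) = _
  refine sum_congr rfl fun j _ => ?_
  linear_combination
    -(scaledCoord p q (2 * j + 1) x * scaledCoord p q (2 * j + 1) x) * Complex.I_mul_I

/-- The representation of `Cl(p,q)` on the exterior algebra of `ℂ^N`, where `p + q ≤ 2N`. -/
noncomputable def spinorRep {p q N : ℕ} (hN : p + q ≤ 2 * N) :
    Cl p q →ₐ[ℂ] Module.End ℂ (ExteriorAlgebra ℂ (Fin N → ℂ)) :=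
  CliffordAlgebra.lift (form p q)
    ⟨{ toFun := fun x => cliffordAct (spinorVec p q N x) (spinorDual p q N x)
       map_add' := fun x y => by
        simp only [cliffordAct, map_add]
        refine LinearMap.ext fun z => ?_
        simp [add_mul]
        abel
       map_smul' := fun c x => by
        simp only [cliffordAct, map_smul]
        refine LinearMap.ext fun z => ?_
        simp },
    fun x => by
      change cliffordAct _ _ * cliffordAct _ _ = _
      rw [cliffordAct_mul_self, spinorDual_spinorVec hN, Algebra.algebraMap_eq_smul_one]⟩

theorem spinorRep_injective {p q N : ℕ} (hN : p + q ≤ 2 * N) :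
    Function.Injective (spinorRep hN) := by
  have := Module.Finite.of_basis (Pi.basisFun ℂ (Fin N)).ExteriorAlgebra
  have : Nontrivial (ExteriorAlgebra ℂ (Fin N → ℂ)) := inferInstance
  refine injective_of_trace_blade _ fun A hA => ?_
  by_cases h : A ≠ univ ∨ Even (p + q)
  · exact trace_blade_eq_zero _ hA h
  · rw [not_or, not_not, Nat.not_even_iff_odd] at h
    obtain ⟨rfl, hn⟩ := h
    -- No generator anticommutes with this central blade, but parity anticommutes with every
    -- generator, hence with a product of an odd number of them.
    refine trace_eq_zero_of_anticomm one_ne_zero parity_mul_self ?_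
    rw [blade, map_list_prod]
    set l := ((univ.sort (· ≤ ·)).map (gen p q)).map (spinorRep hN)
    have hl : Odd l.length := by simpa [l] using hn
    refine mul_list_prod_of_anticomm_of_odd _ hl ?_
    intro x hx
    simp only [l, List.mem_map] at hx
    obtain ⟨_, ⟨a, -, rfl⟩, rfl⟩ := hx
    rw [gen, spinorRep, CliffordAlgebra.lift_ι_apply]
    exact parity_mul_cliffordAct _ _

end Spinor

/-! ### Transfer to matrices -/

section Matrix

variable {p q d : ℕ}

theorem two_pow_le_of_injective (γ : Cl p q →ₐ[ℂ] Matrix (Fin d) (Fin d) ℂ)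
    (hγ : Function.Injective γ) : 2 ^ ((p + q + 1) / 2) ≤ d := by
  have := two_pow_le_finrank_of_injective
    ((Matrix.toLinAlgEquiv' : Matrix (Fin d) (Fin d) ℂ ≃ₐ[ℂ] _).toAlgHom.comp γ)
    (Matrix.toLinAlgEquiv'.injective.comp hγ)
  rwa [Module.finrank_fin_fun] at this

theorem exists_isMinimalRep (p q : ℕ) : ∃ γ : Cl p q →ₐ[ℂ]
    Matrix (Fin (2 ^ ((p + q + 1) / 2))) (Fin (2 ^ ((p + q + 1) / 2))) ℂ, IsMinimalRep γ := by
  set N := (p + q + 1) / 2 with hN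
  let b := (Pi.basisFun ℂ (Fin N)).ExteriorAlgebra.reindex
    (Fintype.equivFinOfCardEq (by rw [Fintype.card_finset, Fintype.card_fin] :
      Fintype.card (Finset (Fin N)) = 2 ^ N))
  have hpq : p + q ≤ 2 * N := by omega
  refine ⟨(LinearMap.toMatrixAlgEquiv b).toAlgHom.comp (spinorRep hpq),
    (LinearMap.toMatrixAlgEquiv b).injective.comp (spinorRep_injective hpq), fun m β hβ => ?_⟩
  exact two_pow_le_of_injective β hβ

theorem IsMinimalRep.dim_eq {γ : Cl p q →ₐ[ℂ] Matrix (Fin d) (Fin d) ℂ} (h : IsMinimalRep γ) :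
    d = 2 ^ ((p + q + 1) / 2) := by
  obtain ⟨β, hβ⟩ := exists_isMinimalRep p q
  exact le_antisymm (h.2 _ β hβ.1) (two_pow_le_of_injective γ h.1)

theorem IsMinimalRep.Tr_eq {γ : Cl p q →ₐ[ℂ] Matrix (Fin d) (Fin d) ℂ} (h : IsMinimalRep γ)
    (U : Cl p q) : Tr U = 1 / (2 : ℂ) ^ ((p + q + 1) / 2) * (γ U).trace := by
  have := trace_eq_of_injective
    ((Matrix.toLinAlgEquiv' : Matrix (Fin d) (Fin d) ℂ ≃ₐ[ℂ] _).toAlgHom.comp γ)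
    (Matrix.toLinAlgEquiv'.injective.comp h.1) (by rw [Module.finrank_fin_fun, h.dim_eq]) U
  have ht : (γ U).trace = 2 ^ ((p + q + 1) / 2) * Tr U :=
    (Matrix.trace_toLin'_eq (γ U)).symm.trans this
  rw [ht, ← mul_assoc, one_div, inv_mul_cancel₀ (pow_ne_zero _ two_ne_zero), one_mul]

end Matrix

end CliffordTrace

theorem mainTheorem4 (p q : ℕ) (hn : 1 ≤ p + q) :
    -- matrix representations of minimal dimension exist, and their dimension is `2^[(n+1)/2]`
    (∃ γ : CliffordTrace.Cl p q →ₐ[ℂ]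
        Matrix (Fin (2 ^ ((p + q + 1) / 2))) (Fin (2 ^ ((p + q + 1) / 2))) ℂ,
      CliffordTrace.IsMinimalRep γ) ∧
    -- the formula, for every matrix representation of minimal dimension
    (∀ (d : ℕ) (γ : CliffordTrace.Cl p q →ₐ[ℂ] Matrix (Fin d) (Fin d) ℂ),
      CliffordTrace.IsMinimalRep γ → ∀ U : CliffordTrace.Cl p q,
        CliffordTrace.Tr U = 1 / (2 : ℂ) ^ ((p + q + 1) / 2) * (γ U).trace) ∧
    -- the right-hand side does not depend on the representation
    (∀ (d₁ d₂ : ℕ) (γ₁ : CliffordTrace.Cl p q →ₐ[ℂ] Matrix (Fin d₁) (Fin d₁) ℂ)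
      (γ₂ : CliffordTrace.Cl p q →ₐ[ℂ] Matrix (Fin d₂) (Fin d₂) ℂ),
      CliffordTrace.IsMinimalRep γ₁ → CliffordTrace.IsMinimalRep γ₂ →
        ∀ U : CliffordTrace.Cl p q,
          1 / (2 : ℂ) ^ ((p + q + 1) / 2) * (γ₁ U).trace =
            1 / (2 : ℂ) ^ ((p + q + 1) / 2) * (γ₂ U).trace) ∧
    -- the two definitions of the trace are equivalent
    (∀ T : CliffordTrace.Cl p q → ℂ,
      (∃ (d : ℕ) (γ : CliffordTrace.Cl p q →ₐ[ℂ] Matrix (Fin d) (Fin d) ℂ),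
        CliffordTrace.IsMinimalRep γ ∧
          ∀ U : CliffordTrace.Cl p q,
            T U = 1 / (2 : ℂ) ^ ((p + q + 1) / 2) * (γ U).trace) ↔
        T = CliffordTrace.Tr) := by
  have h := fun (d : ℕ) (γ : CliffordTrace.Cl p q →ₐ[ℂ] Matrix (Fin d) (Fin d) ℂ)
    (hγ : CliffordTrace.IsMinimalRep γ) => hγ.Tr_eq
  refine ⟨CliffordTrace.exists_isMinimalRep p q, h, fun d₁ d₂ γ₁ γ₂ h₁ h₂ U => ?_, fun T => ?_⟩
  · rw [← h d₁ γ₁ h₁, ← h d₂ γ₂ h₂]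
  · constructor
    · rintro ⟨d, γ, hγ, hT⟩
      funext U
      rw [hT, ← h d γ hγ]
    · rintro rfl
      obtain ⟨γ, hγ⟩ := CliffordTrace.exists_isMinimalRep p q
      exact ⟨_, γ, hγ, h _ γ hγ⟩
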